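/- **Theorem 3.1.** For real $a$ and integers $k\ge 0$ write $(a)_0=1$, $(a)_k=a(a+1)\cdots(a+k-1)$. For real $\alpha,\beta>-1$, real $x$ and integers $0\le \ell\le N$ let $$Q_\ell(x,\alpha,\beta,N)=\sum_{k=0}^{\ell}\frac{(-\ell)_k(\ell+\alpha+\beta+1)_k(-x)_k}{k!\,(\alpha+1)_k(-N)_k}$$ be the Hahn polynomials, and let $$h_\ell(x,\alpha,\beta,N)=\frac{(\alpha+1)_\ell}{(\beta+1)_\ell}\,Q_\ell(x,\alpha,\beta,N).$$ Then for all integers $N\ge 0$, all real $\alpha,\beta>-1$ and all real $x$ the following identities hold (for each integer $n$ in the range given; empty sums are $0$). (a) For $1\le n\le N-1$: $$\begin{aligned} &\sum_{\ell=1}^{n-1}\frac{2\ell+\alpha+\beta+1}{N}\{(\alpha+\beta+1)(2\ell-N)+2\ell^2\}\left\{\frac{(\alpha+\beta+2)_{\ell-1}}{(N+\alpha+\beta+2)_\ell}\binom{N}{\ell}h_\ell(x,\alpha,\beta,N)\right\}^2\\ &+\left\{\binom{N-1}{n-1}\frac{(\alpha+\beta+2)_{n-1}}{(N+\alpha+\beta+2)_{n-1}}h_n(x,\alpha,\beta,N)\right\}^2\\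 &+(\beta-\alpha)\left(1-\frac xN\right)\sum_{\ell=0}^{n-1}\frac{2\ell+\alpha+\beta+2}{(\beta+1)^2}\left\{\binom{N-1}{\ell}\frac{(\alpha+\beta+2)_\ell}{(\alpha+\beta+N+2)_\ell}h_\ell(x,\alpha,\beta+1,N-1)\right\}^2\\ &=1-\frac xN\left(1-\frac xN\right)\left\{\frac{(\alpha+\beta+2)_n}{(\alpha+\beta+N+2)_{n-1}}\binom{N-2}{n-1}\frac{h_{n-1}(x-1,\alpha+1,\beta+1,N-2)}{\beta+1}\right\}^2. \end{aligned}$$ (b) For $0\le n\le N-1$: $$\begin{aligned} &\sum_{\ell=1}^{n}\frac{2\ell+\alpha+\beta+1}{N}\{(\alpha+\beta+1)(2\ell-N)+2\ell^2\}\left\{\binom{N}{\ell}\frac{(\alpha+\beta+2)_{\ell-1}}{(\alpha+\beta+N+2)_\ell}Q_\ell(x,\alpha,\beta,N)\right\}^2\\ &+\frac xN\left\{\binom{N-1}{n}\frac{(\alpha+\beta+2)_n}{(\alpha+\beta+N+2)_n}\,\frac{\alpha+n+1}{\alpha+1}\,Q_n(x-1,\alpha+1,\beta,N-1)\right\}^2\\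 &+(\alpha-\beta)\frac xN\sum_{\ell=0}^{n-1}(2\ell+\alpha+\beta+2)\left\{\binom{N-1}{\ell}\frac{(\alpha+\beta+2)_\ell}{(\alpha+\beta+N+2)_\ell}\,\frac{Q_\ell(x-1,\alpha+1,\beta,N-1)}{\alpha+1}\right\}^2\\ &=1-\left(1-\frac xN\right)\left\{\binom{N-1}{n}\frac{(\alpha+\beta+2)_n}{(\alpha+\beta+N+2)_n}Q_n(x,\alpha,\beta+1,N-1)\right\}^2. \end{aligned}$$ (c) For $0\le n\le N-2$: $$\begin{aligned} &x\left(1-\frac xN\right)\sum_{\ell=0}^{n-1}\{(\alpha+\beta+\ell+2)(N-2\ell-2)-(\ell+1)N\}(2\ell+\alpha+\beta+3)\left\{\frac{h_\ell(x-1,\alpha+1,\beta+1,N-2)}{(\beta+1)(N-1)}\right\}^2\\ &+\frac xN\left(1-\frac xN\right)\left\{\frac{(\alpha+\beta+2+n)(N-n-1)}{(\beta+1)(N-1)}h_n(x-1,\alpha+1,\beta+1,N-2)\right\}^2\\ &+(\beta-\alpha)\left(1-\frac xN\right)\sum_{\ell=0}^{n}(2\ell+\alpha+\beta+2)\left\{\frac{h_\ell(x,\alpha,\beta+1,N-1)}{\beta+1}\right\}^2\\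 &=1-\{h_{n+1}(x,\alpha,\beta,N)\}^2. \end{aligned}$$ (d) For $0\le n\le N-1$: $$\begin{aligned} &\sum_{\ell=1}^{n}\frac{2\ell+\alpha+\beta+1}{N}\{(\alpha+\beta+1)(2\ell-N)+2\ell^2\}\left\{\frac{(\alpha+\beta+2)_{\ell-1}}{(\alpha+\beta+N+2)_\ell}\binom{N}{\ell}h_\ell(x,\alpha,\beta,N)\right\}^2\\ &+(\beta-\alpha)\left(1-\frac xN\right)\sum_{\ell=0}^{n-1}(2\ell+\alpha+\beta+2)\left\{\binom{N-1}{\ell}\frac{(\alpha+\beta+2)_\ell}{(\alpha+\beta+N+2)_\ell}\,\frac{h_\ell(x,\alpha,\beta+1,N-1)}{\beta+1}\right\}^2\\ &+\left(1-\frac xN\right)\left\{\binom{N-1}{n}\frac{\beta+n+1}{\beta+1}\,\frac{(\alpha+\beta+2)_n}{(\alpha+\beta+N+2)_n}h_n(x,\alpha,\beta+1,N-1)\right\}^2\\ &=1-\frac xN\left\{\binom{N-1}{n}\frac{(\alpha+\beta+2)_n}{(\alpha+\beta+N+2)_n}h_n(x-1,\alpha+1,\beta,N-1)\right\}^2. \end{aligned}$$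 -/

import Mathlib

/-- The Pochhammer symbol `(a)_k = a (a + 1) ⋯ (a + k - 1)`, with `(a)_0 = 1`. -/
noncomputable def poch (a : ℝ) (k : ℕ) : ℝ := (ascPochhammer ℝ k).eval a

/-- The Hahn polynomial `Q_n(x, α, β, N) = ₃F₂(-n, n + α + β + 1, -x; α + 1, -N; 1)`, written as the
terminating sum; it is used for `n ≤ N` and `α, β > -1`, where no denominator vanishes. -/
noncomputable def hahnQ (n : ℕ) (x α β : ℝ) (N : ℕ) : ℝ :=
  ∑ k ∈ Finset.range (n + 1),
    (poch (-(n : ℝ)) k * poch ((n : ℝ) + α + β + 1) k * poch (-x) k) /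
      ((k.factorial : ℝ) * poch (α + 1) k * poch (-(N : ℝ)) k)

/-- The rescaled Hahn polynomial `h_ℓ(x, α, β, N) = (α + 1)_ℓ / (β + 1)_ℓ * Q_ℓ(x, α, β, N)`. -/
noncomputable def hahnH (l : ℕ) (x α β : ℝ) (N : ℕ) : ℝ :=
  poch (α + 1) l / poch (β + 1) l * hahnQ l x α β N

/-! Replacing z^k by (-x)_k / (-N)_k turns a Jacobi polynomial ₂F₁(-n, n+α+β+1; α+1; z) into Q_n.
Let L_{x,N} be this linear map on polynomials of small enough degree. Then L_{x,N}(z f) = (x/N)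
L_{x-1,N-1} f, L_{x,N}((1-z) f) = (1 - x/N) L_{x,N-1} f, and N L_{x,N} f equals both L_{x,N-1}((N -
z d/dz) f) and L_{x-1,N-1}((N + (1-z) d/dz) f). Four Jacobi relations, checked coefficient by
coefficient, thus become four linear contiguous relations for Q_n, and after rescaling for h_n.

Each identity follows by induction on n: its increment is a quadratic form in a few Hahn values,
which the contiguous relations force to vanish. Put w_n = C(N-1,n) (α+β+2)_n / (α+β+N+2)_n, g =
(n+1)(α+β+N+2+n) and q = (N-n-1)(α+β+2+n). Then w_{n+1} = (q/g) w_n, and g² - q² = N (2n+α+β+3) e,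
where e is the factor (α+β+1)(2ℓ-N) + 2ℓ² at ℓ = n+1.

Identities (b) and (d) share `sq_increment_of_contiguous`, being exchanged by the reflection
h_n(x,α,β,N) = (-1)^n Q_n(N-x,β,α,N). Identity (c) rests on `succ_sq_increment_of_contiguous`, and
the increment of (a) is w_{n+1}² times that of (c). -/

lemma poch_zero (a : ℝ) : poch a 0 = 1 := by simp [poch]

lemma poch_succ (a : ℝ) (k : ℕ) : poch a (k + 1) = poch a k * (a + k) := by
  simp [poch, ascPochhammer_succ_eval]

lemma poch_succ_left (a : ℝ) (k : ℕ) : poch a (k + 1) = a * poch (a + 1) k := by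
  simp [poch, ascPochhammer_succ_left]

lemma poch_pos {a : ℝ} (ha : 0 < a) (k : ℕ) : 0 < poch a k :=
  ascPochhammer_pos k a ha

lemma poch_neg_natCast_eq_zero {n k : ℕ} (h : n < k) : poch (-(n : ℝ)) k = 0 := by
  induction k, h using Nat.le_induction with
  | base => rw [poch_succ]; simp
  | succ m _ ih => rw [poch_succ, ih, zero_mul]

lemma poch_neg_natCast_ne_zero {N k : ℕ} (h : k ≤ N) : poch (-(N : ℝ)) k ≠ 0 := by
  induction k with
  | zero => simp [poch_zero]
  | succ k ih =>
    rw [poch_succ]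
    have hk : (k : ℝ) < N := by exact_mod_cast h
    exact mul_ne_zero (ih (by omega)) (by linarith)

/-! ### Jacobi coefficients and the substitute for powers of z -/

/-- The coefficients of the Jacobi polynomial `₂F₁(-n, n + α + β + 1; α + 1; z)`. -/
noncomputable def jacobiCoeff (n : ℕ) (α β : ℝ) (k : ℕ) : ℝ :=
  poch (-(n : ℝ)) k * poch ((n : ℝ) + α + β + 1) k / ((k.factorial : ℝ) * poch (α + 1) k)

/-- The quotient `(-x)_k / (-N)_k`, which takes the place of `z ^ k` in the Hahn polynomials. -/
noncomputable def hahnPow (x : ℝ) (N k : ℕ) : ℝ := poch (-x) k / poch (-(N : ℝ)) k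

lemma jacobiCoeff_zero (n : ℕ) (α β : ℝ) : jacobiCoeff n α β 0 = 1 := by
  simp [jacobiCoeff, poch_zero]

lemma jacobiCoeff_eq_zero {n k : ℕ} (h : n < k) (α β : ℝ) : jacobiCoeff n α β k = 0 := by
  simp [jacobiCoeff, poch_neg_natCast_eq_zero h]

lemma hahnPow_zero (x : ℝ) (N : ℕ) : hahnPow x N 0 = 1 := by
  simp [hahnPow, poch_zero]

lemma hahnQ_eq_sum (n : ℕ) (x α β : ℝ) (N : ℕ) :
    hahnQ n x α β N = ∑ k ∈ Finset.range (n + 1), jacobiCoeff n α β k * hahnPow x N k := by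
  refine Finset.sum_congr rfl fun k _ => ?_
  rw [jacobiCoeff, hahnPow, div_mul_div_comm]

/-- Padding with a vanishing top term lets degrees n and n + 1 be compared over the same range. -/
lemma hahnQ_eq_sum_succ (n : ℕ) (x α β : ℝ) (N : ℕ) :
    hahnQ n x α β N = ∑ k ∈ Finset.range (n + 2), jacobiCoeff n α β k * hahnPow x N k := by
  rw [Finset.sum_range_succ, jacobiCoeff_eq_zero (Nat.lt_succ_self n), zero_mul, add_zero,
    hahnQ_eq_sum]

lemma hahnQ_zero (x α β : ℝ) (N : ℕ) : hahnQ 0 x α β N = 1 := by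
  simp [hahnQ_eq_sum, jacobiCoeff_zero, hahnPow_zero]

/-- The image of multiplication by z. -/
lemma hahnPow_succ_succ (x : ℝ) (M k : ℕ) :
    hahnPow x (M + 1) (k + 1) = x / ((M : ℝ) + 1) * hahnPow (x - 1) M k := by
  have h : -((M + 1 : ℕ) : ℝ) + 1 = -(M : ℝ) := by push_cast; ring
  have h' : -x + 1 = -(x - 1) := by ring
  rw [hahnPow, hahnPow, poch_succ_left, poch_succ_left, h, h', mul_div_mul_comm, neg_div_neg_eq]
  push_cast
  rfl

/-- The image of N - z d/dz with N = M + 1. The bound on k keeps (-M)_k nonzero. -/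
lemma hahnPow_succ_left (x : ℝ) {M k : ℕ} (hk : k ≤ M) :
    ((M : ℝ) + 1) * hahnPow x (M + 1) k = ((M : ℝ) + 1 - k) * hahnPow x M k := by
  have h : -((M + 1 : ℕ) : ℝ) + 1 = -(M : ℝ) := by push_cast; ring
  have h1 := poch_succ (-((M + 1 : ℕ) : ℝ)) k
  rw [poch_succ_left, h] at h1
  have h2 := poch_neg_natCast_ne_zero hk
  have h3 := poch_neg_natCast_ne_zero (show k ≤ M + 1 by omega)
  rw [hahnPow, hahnPow]
  field_simp
  push_cast at h1 ⊢
  linear_combination (-poch (-x) k) * h1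

/-- The image of multiplication by 1 - z. -/
lemma hahnPow_sub_succ (x : ℝ) {M k : ℕ} (hk : k ≤ M) :
    hahnPow x (M + 1) k - hahnPow x (M + 1) (k + 1) =
      (1 - x / ((M : ℝ) + 1)) * hahnPow x M k := by
  have h : -((M + 1 : ℕ) : ℝ) + 1 = -(M : ℝ) := by push_cast; ring
  have h1 := hahnPow_succ_left x hk
  have h2 : ((M : ℝ) + 1) * hahnPow x (M + 1) (k + 1) = (x - k) * hahnPow x M k := by
    have h3 := poch_neg_natCast_ne_zero hk
    rw [hahnPow, hahnPow, poch_succ, poch_succ_left (-((M + 1 : ℕ) : ℝ)), h]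
    have : -((M + 1 : ℕ) : ℝ) = -((M : ℝ) + 1) := by push_cast; ring
    rw [this]
    field_simp
    ring
  have hM : (M : ℝ) + 1 ≠ 0 := by positivity
  refine mul_left_cancel₀ hM ?_
  field_simp
  linear_combination h1 - h2

/-- The image of N + (1 - z) d/dz acting on z^(k+1), with N = M + 1. -/
lemma hahnPow_succ_eq (x : ℝ) {M k : ℕ} (hk : k + 1 ≤ M) :
    ((M : ℝ) + 1) * hahnPow x (M + 1) (k + 1) =
      ((M : ℝ) - k) * hahnPow (x - 1) M (k + 1) + (k + 1) * hahnPow (x - 1) M k := by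
  have hM : (M : ℝ) + 1 ≠ 0 := by positivity
  have hkM : (k : ℝ) + 1 ≤ M := by exact_mod_cast hk
  have h3 := poch_neg_natCast_ne_zero (show k ≤ M by omega)
  rw [hahnPow_succ_succ, hahnPow, hahnPow, poch_succ, poch_succ]
  have h4 : -(M : ℝ) + k ≠ 0 := by linarith
  field_simp
  ring

/-! ### Contiguous relations for Jacobi coefficients -/

section

variable {α β : ℝ}

/-- Coefficient of z^(k+1) in (α+1)(P_n - P_{n+1}) = (2n+α+β+2) z P_n^(α+1,β), where P_n has
constant term 1. -/
lemma jacobiCoeff_sub_succ (hα : -1 < α) (n k : ℕ) :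
    (α + 1) * (jacobiCoeff n α β (k + 1) - jacobiCoeff (n + 1) α β (k + 1)) =
      (2 * (n : ℝ) + α + β + 2) * jacobiCoeff n (α + 1) β k := by
  have h : -((n + 1 : ℕ) : ℝ) + 1 = -(n : ℝ) := by push_cast; ring
  have e1 : ((n + 1 : ℕ) : ℝ) + α + β + 1 = (n : ℝ) + α + β + 1 + 1 := by push_cast; ring
  have e2 : (n : ℝ) + (α + 1) + β + 1 = (n : ℝ) + α + β + 1 + 1 := by ring
  have h1 := (poch_pos (show 0 < α + 1 + 1 by linarith) k).ne'
  have h2 : α + 1 ≠ 0 := by linarith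
  have h3 : (k.factorial : ℝ) ≠ 0 := by positivity
  simp only [jacobiCoeff]
  rw [e1, e2, poch_succ_left (-((n + 1 : ℕ) : ℝ)), h, poch_succ (-(n : ℝ)),
    poch_succ_left ((n : ℝ) + α + β + 1), poch_succ ((n : ℝ) + α + β + 1 + 1),
    poch_succ_left (α + 1), Nat.factorial_succ]
  push_cast
  field_simp
  ring

/-- The companion relation, with (1 - z) P_n^(α,β+1) on the right up to sign conventions of the
shift: the right-hand difference is the coefficient of z^(k+1) in that product. -/
lemma jacobiCoeff_add_succ (hα : -1 < α) (n k : ℕ) :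
    (β + n + 1) * jacobiCoeff n α β (k + 1) + (α + n + 1) * jacobiCoeff (n + 1) α β (k + 1) =
      (2 * (n : ℝ) + α + β + 2) *
        (jacobiCoeff n α (β + 1) (k + 1) - jacobiCoeff n α (β + 1) k) := by
  have h : -((n + 1 : ℕ) : ℝ) + 1 = -(n : ℝ) := by push_cast; ring
  have e1 : ((n + 1 : ℕ) : ℝ) + α + β + 1 = (n : ℝ) + α + β + 1 + 1 := by push_cast; ring
  have e2 : (n : ℝ) + α + (β + 1) + 1 = (n : ℝ) + α + β + 1 + 1 := by ring
  have h1 := (poch_pos (show 0 < α + 1 by linarith) k).ne'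
  have h2 : α + 1 + k ≠ 0 := by have : (0 : ℝ) ≤ k := k.cast_nonneg; linarith
  have h3 : (k.factorial : ℝ) ≠ 0 := by positivity
  simp only [jacobiCoeff]
  rw [e1, e2, poch_succ_left (-((n + 1 : ℕ) : ℝ)), h, poch_succ (-(n : ℝ)),
    poch_succ_left ((n : ℝ) + α + β + 1), poch_succ ((n : ℝ) + α + β + 1 + 1),
    poch_succ (α + 1), Nat.factorial_succ]
  push_cast
  field_simp
  ring

/-- Expands (N - z d/dz) P_{n+1} in the polynomials with β raised; N is a free parameter here. -/
lemma jacobiCoeff_succ_beta (hα : -1 < α) (N : ℝ) (n k : ℕ) :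
    (N - k) * (2 * (n : ℝ) + α + β + 3) * jacobiCoeff (n + 1) α β k =
      (N - n - 1) * (n + α + β + 2) * jacobiCoeff (n + 1) α (β + 1) k +
        (n + 1) * (N + n + α + β + 2) * jacobiCoeff n α (β + 1) k := by
  cases k with
  | zero => simp only [jacobiCoeff_zero]; push_cast; ring
  | succ k =>
    have h : -((n + 1 : ℕ) : ℝ) + 1 = -(n : ℝ) := by push_cast; ring
    have e1 : ((n + 1 : ℕ) : ℝ) + α + β + 1 = (n : ℝ) + α + β + 2 := by push_cast; ring
    have e2 : ((n + 1 : ℕ) : ℝ) + α + (β + 1) + 1 = (n : ℝ) + α + β + 2 + 1 := by push_cast; ring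
    have e3 : (n : ℝ) + α + (β + 1) + 1 = (n : ℝ) + α + β + 2 := by ring
    have h1 := (poch_pos (show 0 < α + 1 by linarith) (k + 1)).ne'
    have h3 : ((k + 1).factorial : ℝ) ≠ 0 := by positivity
    simp only [jacobiCoeff]
    rw [e1, e2, e3, poch_succ_left (-((n + 1 : ℕ) : ℝ)), h, poch_succ (-(n : ℝ)),
      poch_succ_left ((n : ℝ) + α + β + 2), poch_succ ((n : ℝ) + α + β + 2 + 1)]
    push_cast
    field_simp
    ring

/-- Expands (N + (1 - z) d/dz) P_{n+1} in the polynomials with α raised. -/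
lemma jacobiCoeff_succ_alpha (hα : -1 < α) (N : ℝ) (n k : ℕ) :
    (α + 1) * (2 * (n : ℝ) + α + β + 3) *
        ((N - k) * jacobiCoeff (n + 1) α β k + (k + 1) * jacobiCoeff (n + 1) α β (k + 1)) =
      (N - n - 1) * (n + α + β + 2) * (α + n + 2) * jacobiCoeff (n + 1) (α + 1) β k -
        (n + 1) * (N + n + α + β + 2) * (β + n + 1) * jacobiCoeff n (α + 1) β k := by
  have h : -((n + 1 : ℕ) : ℝ) + 1 = -(n : ℝ) := by push_cast; ring
  have e1 : ((n + 1 : ℕ) : ℝ) + α + β + 1 = (n : ℝ) + α + β + 2 := by push_cast; ring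
  have e2 : ((n + 1 : ℕ) : ℝ) + (α + 1) + β + 1 = (n : ℝ) + α + β + 2 + 1 := by push_cast; ring
  have e3 : (n : ℝ) + (α + 1) + β + 1 = (n : ℝ) + α + β + 2 := by ring
  have h2 : α + 1 ≠ 0 := by linarith
  cases k with
  | zero =>
    simp only [jacobiCoeff_zero]
    simp only [jacobiCoeff]
    rw [e1, poch_succ, poch_succ, poch_succ, poch_zero, poch_zero, poch_zero]
    simp only [zero_add, Nat.factorial_one, Nat.cast_zero, add_zero]
    push_cast
    field_simp
    ring
  | succ k =>
    have h1 := (poch_pos (show 0 < α + 1 + 1 by linarith) k).ne'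
    have h3 : (k.factorial : ℝ) ≠ 0 := by positivity
    have h4 : α + 1 + 1 + k ≠ 0 := by have : (0 : ℝ) ≤ k := k.cast_nonneg; linarith
    simp only [jacobiCoeff]
    rw [e1, e2, e3, poch_succ_left (-((n + 1 : ℕ) : ℝ)) (k + 1),
      poch_succ_left (-((n + 1 : ℕ) : ℝ)) k, h, poch_succ (-(n : ℝ)),
      poch_succ_left ((n : ℝ) + α + β + 2) (k + 1), poch_succ_left ((n : ℝ) + α + β + 2) k,
      poch_succ ((n : ℝ) + α + β + 2 + 1), poch_succ_left (α + 1) (k + 1),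
      poch_succ_left (α + 1) k, poch_succ (α + 1 + 1), Nat.factorial_succ (k + 1),
      Nat.factorial_succ]
    push_cast
    field_simp
    ring

/-! ### Contiguous relations for Q -/

lemma hahnQ_sub_succ (hα : -1 < α) (x : ℝ) (M n : ℕ) :
    (α + 1) * (hahnQ n x α β (M + 1) - hahnQ (n + 1) x α β (M + 1)) =
      (2 * (n : ℝ) + α + β + 2) * (x / ((M : ℝ) + 1)) * hahnQ n (x - 1) (α + 1) β M := by
  rw [hahnQ_eq_sum_succ n, hahnQ_eq_sum (n + 1), hahnQ_eq_sum n, Finset.sum_range_succ',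
    Finset.sum_range_succ' _ (n + 1)]
  simp only [jacobiCoeff_zero, add_sub_add_right_eq_sub, ← Finset.sum_sub_distrib, Finset.mul_sum]
  refine Finset.sum_congr rfl fun k _ => ?_
  rw [hahnPow_succ_succ]
  linear_combination x / ((M : ℝ) + 1) * hahnPow (x - 1) M k * jacobiCoeff_sub_succ (β := β) hα n k

lemma hahnQ_add_succ (hα : -1 < α) (x : ℝ) {M n : ℕ} (hn : n ≤ M) :
    (β + n + 1) * hahnQ n x α β (M + 1) + (α + n + 1) * hahnQ (n + 1) x α β (M + 1) =
      (2 * (n : ℝ) + α + β + 2) * (1 - x / ((M : ℝ) + 1)) * hahnQ n x α (β + 1) M := by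
  have hB : (1 - x / ((M : ℝ) + 1)) * hahnQ n x α (β + 1) M =
      hahnQ n x α (β + 1) (M + 1) -
        ∑ k ∈ Finset.range (n + 1), jacobiCoeff n α (β + 1) k * hahnPow x (M + 1) (k + 1) := by
    rw [hahnQ_eq_sum, hahnQ_eq_sum, ← Finset.sum_sub_distrib, Finset.mul_sum]
    refine Finset.sum_congr rfl fun k hk => ?_
    have := hahnPow_sub_succ x (show k ≤ M by have := Finset.mem_range.1 hk; omega)
    linear_combination (-jacobiCoeff n α (β + 1) k) * this
  rw [mul_assoc, hB, hahnQ_eq_sum_succ n, hahnQ_eq_sum (n + 1), hahnQ_eq_sum_succ n,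
    Finset.sum_range_succ', Finset.sum_range_succ' _ (n + 1), Finset.sum_range_succ' _ (n + 1)]
  simp only [jacobiCoeff_zero, hahnPow_zero]
  have : ∑ k ∈ Finset.range (n + 1), ((β + n + 1) * jacobiCoeff n α β (k + 1) +
        (α + n + 1) * jacobiCoeff (n + 1) α β (k + 1)) * hahnPow x (M + 1) (k + 1) =
      ∑ k ∈ Finset.range (n + 1), (2 * (n : ℝ) + α + β + 2) *
        (jacobiCoeff n α (β + 1) (k + 1) - jacobiCoeff n α (β + 1) k) *
          hahnPow x (M + 1) (k + 1) :=
    Finset.sum_congr rfl fun k _ => by rw [jacobiCoeff_add_succ hα]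
  simp only [add_mul, sub_mul, mul_sub, mul_assoc, Finset.sum_add_distrib, Finset.sum_sub_distrib,
    ← Finset.mul_sum] at this
  linear_combination this

lemma hahnQ_succ_beta (hα : -1 < α) (x : ℝ) {M n : ℕ} (hn : n + 1 ≤ M) :
    ((M : ℝ) + 1) * (2 * (n : ℝ) + α + β + 3) * hahnQ (n + 1) x α β (M + 1) =
      ((M : ℝ) - n) * (n + α + β + 2) * hahnQ (n + 1) x α (β + 1) M +
        (n + 1) * ((M : ℝ) + n + α + β + 3) * hahnQ n x α (β + 1) M := by
  rw [hahnQ_eq_sum_succ n, hahnQ_eq_sum (n + 1), hahnQ_eq_sum (n + 1)]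
  simp only [Finset.mul_sum, ← Finset.sum_add_distrib]
  refine Finset.sum_congr rfl fun k hk => ?_
  have h := hahnPow_succ_left x (show k ≤ M by have := Finset.mem_range.1 hk; omega)
  have h' := jacobiCoeff_succ_beta (β := β) hα ((M : ℝ) + 1) n k
  linear_combination (2 * (n : ℝ) + α + β + 3) * jacobiCoeff (n + 1) α β k * h +
    hahnPow x M k * h'

lemma hahnQ_succ_alpha (hα : -1 < α) (x : ℝ) {M n : ℕ} (hn : n + 1 ≤ M) :
    ((M : ℝ) + 1) * (2 * (n : ℝ) + α + β + 3) * (α + 1) * hahnQ (n + 1) x α β (M + 1) =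
      ((M : ℝ) - n) * (n + α + β + 2) * (α + n + 2) * hahnQ (n + 1) (x - 1) (α + 1) β M -
        (n + 1) * ((M : ℝ) + n + α + β + 3) * (β + n + 1) * hahnQ n (x - 1) (α + 1) β M := by
  -- Summation by parts: the operator N + (1 - z) d/dz moves from the powers to the coefficients.
  have hA : ((M : ℝ) + 1) * hahnQ (n + 1) x α β (M + 1) =
      ∑ k ∈ Finset.range (n + 2), (((M : ℝ) + 1 - k) * jacobiCoeff (n + 1) α β k +
        (k + 1) * jacobiCoeff (n + 1) α β (k + 1)) * hahnPow (x - 1) M k := by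
    have h1 : ((M : ℝ) + 1) * hahnQ (n + 1) x α β (M + 1) =
        ∑ k ∈ Finset.range (n + 1), jacobiCoeff (n + 1) α β (k + 1) *
          (((M : ℝ) - k) * hahnPow (x - 1) M (k + 1) + (k + 1) * hahnPow (x - 1) M k) +
            ((M : ℝ) + 1) := by
      rw [hahnQ_eq_sum, Finset.sum_range_succ', jacobiCoeff_zero, hahnPow_zero, mul_add,
        Finset.mul_sum, mul_one, mul_one]
      congr 1
      refine Finset.sum_congr rfl fun k hk => ?_
      rw [← hahnPow_succ_eq x (show k + 1 ≤ M by have := Finset.mem_range.1 hk; omega)]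
      ring
    have h2 : ∑ k ∈ Finset.range (n + 2), ((M : ℝ) + 1 - k) * jacobiCoeff (n + 1) α β k *
          hahnPow (x - 1) M k =
        ∑ k ∈ Finset.range (n + 1), ((M : ℝ) - k) * jacobiCoeff (n + 1) α β (k + 1) *
          hahnPow (x - 1) M (k + 1) + ((M : ℝ) + 1) := by
      rw [Finset.sum_range_succ', jacobiCoeff_zero, hahnPow_zero]
      push_cast
      congr 1
      · exact Finset.sum_congr rfl fun k _ => by ring
      · ring
    have h3 : ∑ k ∈ Finset.range (n + 2), ((k : ℝ) + 1) * jacobiCoeff (n + 1) α β (k + 1) *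
          hahnPow (x - 1) M k =
        ∑ k ∈ Finset.range (n + 1), ((k : ℝ) + 1) * jacobiCoeff (n + 1) α β (k + 1) *
          hahnPow (x - 1) M k := by
      rw [Finset.sum_range_succ, jacobiCoeff_eq_zero (Nat.lt_succ_self (n + 1))]
      ring
    simp only [add_mul _ _ (hahnPow _ _ _), Finset.sum_add_distrib]
    rw [h1, h2, h3, add_right_comm, ← Finset.sum_add_distrib]
    congr 1
    exact Finset.sum_congr rfl fun k _ => by ring
  have hs : ((M : ℝ) + 1) * (2 * (n : ℝ) + α + β + 3) * (α + 1) * hahnQ (n + 1) x α β (M + 1) =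
      (α + 1) * (2 * (n : ℝ) + α + β + 3) * (((M : ℝ) + 1) * hahnQ (n + 1) x α β (M + 1)) := by
    ring
  rw [hs, hA, hahnQ_eq_sum_succ n, hahnQ_eq_sum (n + 1)]
  simp only [Finset.mul_sum, ← Finset.sum_sub_distrib]
  refine Finset.sum_congr rfl fun k _ => ?_
  have h' := jacobiCoeff_succ_alpha (β := β) hα ((M : ℝ) + 1) n k
  linear_combination hahnPow (x - 1) M k * h'

end

/-! ### Contiguous relations for h -/

section

variable {α β : ℝ}

lemma poch_succ_shift (a : ℝ) (k : ℕ) : poch a k * (a + k) = a * poch (a + 1) k := by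
  rw [← poch_succ, poch_succ_left]

lemma hahnH_zero (x α β : ℝ) (N : ℕ) : hahnH 0 x α β N = 1 := by
  simp [hahnH, hahnQ_zero, poch_zero]

/-- This and the next two lemmas extract the common factor (α+1)_n / (β+1)_n, so that relations for
Q transfer to h. -/
lemma hahnH_succ (n : ℕ) (x α β : ℝ) (N : ℕ) :
    hahnH (n + 1) x α β N =
      poch (α + 1) n / poch (β + 1) n * ((α + n + 1) / (β + n + 1)) * hahnQ (n + 1) x α β N := by
  rw [hahnH, poch_succ, poch_succ, mul_div_mul_comm, add_right_comm α, add_right_comm β]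

lemma hahnH_alpha (n : ℕ) (x : ℝ) (N : ℕ) :
    (α + 1) * hahnH n x (α + 1) β N =
      poch (α + 1) n / poch (β + 1) n * (α + n + 1) * hahnQ n x (α + 1) β N := by
  rw [hahnH]
  linear_combination (-hahnQ n x (α + 1) β N / poch (β + 1) n) * poch_succ_shift (α + 1) n

lemma hahnH_beta (hβ : -1 < β) (n : ℕ) (x : ℝ) (N : ℕ) :
    (β + n + 1) * hahnH n x α (β + 1) N =
      poch (α + 1) n / poch (β + 1) n * (β + 1) * hahnQ n x α (β + 1) N := by
  have h1 := (poch_pos (show 0 < β + 1 by linarith) n).ne'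
  have h2 := (poch_pos (show 0 < β + 1 + 1 by linarith) n).ne'
  rw [hahnH]
  field_simp
  linear_combination poch (α + 1) n * hahnQ n x α (β + 1) N * poch_succ_shift (β + 1) n

variable {N : ℕ}

lemma hahnH_sub_succ (hα : -1 < α) (hβ : -1 < β) (x : ℝ) (hN : 1 ≤ N) (n : ℕ) :
    (α + n + 1) * hahnH n x α β N - (β + n + 1) * hahnH (n + 1) x α β N =
      (2 * (n : ℝ) + α + β + 2) * (x / N) * hahnH n (x - 1) (α + 1) β (N - 1) := by
  obtain ⟨M, rfl⟩ : ∃ M, N = M + 1 := ⟨N - 1, by omega⟩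
  have h1 : α + 1 ≠ 0 := by linarith
  have h2 : β + n + 1 ≠ 0 := by have : (0 : ℝ) ≤ n := n.cast_nonneg; linarith
  have h := hahnQ_sub_succ (β := β) hα x M n
  have hC := hahnH_alpha (α := α) (β := β) n (x - 1) M
  rw [Nat.add_sub_cancel]
  refine mul_left_cancel₀ h1 ?_
  have hA := hahnH_succ n x α β (M + 1)
  have hA' : (β + n + 1) * hahnH (n + 1) x α β (M + 1) =
      poch (α + 1) n / poch (β + 1) n * (α + n + 1) * hahnQ (n + 1) x α β (M + 1) := by
    rw [hA]; field_simp
  rw [hahnH]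
  push_cast
  linear_combination poch (α + 1) n / poch (β + 1) n * (α + n + 1) * h - (α + 1) * hA' -
    (2 * (n : ℝ) + α + β + 2) * (x / ((M : ℝ) + 1)) * hC

lemma hahnH_add_succ (hα : -1 < α) (hβ : -1 < β) (x : ℝ) {n : ℕ} (hn : n + 1 ≤ N) :
    (β + 1) * (hahnH n x α β N + hahnH (n + 1) x α β N) =
      (2 * (n : ℝ) + α + β + 2) * (1 - x / N) * hahnH n x α (β + 1) (N - 1) := by
  obtain ⟨M, rfl⟩ : ∃ M, N = M + 1 := ⟨N - 1, by omega⟩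
  have h2 : β + n + 1 ≠ 0 := by have : (0 : ℝ) ≤ n := n.cast_nonneg; linarith
  have h := hahnQ_add_succ (β := β) hα x (show n ≤ M by omega)
  have hB := hahnH_beta (α := α) hβ n x M
  rw [Nat.add_sub_cancel]
  refine mul_left_cancel₀ h2 ?_
  have hA := hahnH_succ n x α β (M + 1)
  have hA' : (β + n + 1) * hahnH (n + 1) x α β (M + 1) =
      poch (α + 1) n / poch (β + 1) n * (α + n + 1) * hahnQ (n + 1) x α β (M + 1) := by
    rw [hA]; field_simp
  rw [hahnH]
  push_cast
  linear_combination poch (α + 1) n / poch (β + 1) n * (β + 1) * h + (β + 1) * hA' -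
    (2 * (n : ℝ) + α + β + 2) * (1 - x / ((M : ℝ) + 1)) * hB

lemma hahnH_succ_beta (hα : -1 < α) (hβ : -1 < β) (x : ℝ) {n : ℕ} (hn : n + 2 ≤ N) :
    (N : ℝ) * (2 * (n : ℝ) + α + β + 3) * (β + 1) * hahnH (n + 1) x α β N =
      ((N : ℝ) - n - 1) * (n + α + β + 2) * (β + n + 2) * hahnH (n + 1) x α (β + 1) (N - 1) +
        (n + 1) * ((N : ℝ) + n + α + β + 2) * (α + n + 1) * hahnH n x α (β + 1) (N - 1) := by
  obtain ⟨M, rfl⟩ : ∃ M, N = M + 1 := ⟨N - 1, by omega⟩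
  have h2 : β + n + 1 ≠ 0 := by have : (0 : ℝ) ≤ n := n.cast_nonneg; linarith
  have h := hahnQ_succ_beta (β := β) hα x (show n + 1 ≤ M by omega)
  have hB := hahnH_beta (α := α) hβ n x M
  have hB' := hahnH_beta (α := α) hβ (n + 1) x M
  have hρ : poch (α + 1) (n + 1) / poch (β + 1) (n + 1) * (β + n + 1) =
      poch (α + 1) n / poch (β + 1) n * (α + n + 1) := by
    rw [poch_succ, poch_succ, mul_div_mul_comm, add_right_comm α, add_right_comm β]
    field_simp
  rw [Nat.add_sub_cancel]
  refine mul_left_cancel₀ h2 ?_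
  rw [hahnH]
  push_cast at hB' ⊢
  linear_combination poch (α + 1) (n + 1) / poch (β + 1) (n + 1) * (β + 1) * (β + n + 1) * h -
    (β + n + 1) * ((M : ℝ) - n) * (n + α + β + 2) * hB' -
    (n + 1) * ((M : ℝ) + n + α + β + 3) * (α + n + 1) * hB +
    (n + 1) * ((M : ℝ) + n + α + β + 3) * (β + 1) * hahnQ n x α (β + 1) M * hρ

lemma hahnH_succ_alpha (hα : -1 < α) (hβ : -1 < β) (x : ℝ) {n : ℕ} (hn : n + 2 ≤ N) :
    (N : ℝ) * (2 * (n : ℝ) + α + β + 3) * hahnH (n + 1) x α β N =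
      ((N : ℝ) - n - 1) * (n + α + β + 2) * hahnH (n + 1) (x - 1) (α + 1) β (N - 1) -
        (n + 1) * ((N : ℝ) + n + α + β + 2) * hahnH n (x - 1) (α + 1) β (N - 1) := by
  obtain ⟨M, rfl⟩ : ∃ M, N = M + 1 := ⟨N - 1, by omega⟩
  have h1 : α + 1 ≠ 0 := by linarith
  have h2 : β + n + 1 ≠ 0 := by have : (0 : ℝ) ≤ n := n.cast_nonneg; linarith
  have h := hahnQ_succ_alpha (β := β) hα x (show n + 1 ≤ M by omega)
  have hC := hahnH_alpha (α := α) (β := β) n (x - 1) M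
  have hC' := hahnH_alpha (α := α) (β := β) (n + 1) (x - 1) M
  have hρ : poch (α + 1) (n + 1) / poch (β + 1) (n + 1) * (β + n + 1) =
      poch (α + 1) n / poch (β + 1) n * (α + n + 1) := by
    rw [poch_succ, poch_succ, mul_div_mul_comm, add_right_comm α, add_right_comm β]
    field_simp
  rw [Nat.add_sub_cancel]
  refine mul_left_cancel₀ h1 ?_
  rw [hahnH]
  push_cast at hC' ⊢
  linear_combination poch (α + 1) (n + 1) / poch (β + 1) (n + 1) * h -
    ((M : ℝ) - n) * (n + α + β + 2) * hC' +
    (n + 1) * ((M : ℝ) + n + α + β + 3) * hC -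
    (n + 1) * ((M : ℝ) + n + α + β + 3) * hahnQ n (x - 1) (α + 1) β M * hρ

/-! ### Weights expressed through w_n -/

lemma choose_mul_poch_div_poch_top (σ : ℝ) {τ : ℝ} (hτ : 0 < τ) (hN : 1 ≤ N) (n : ℕ) :
    (N.choose (n + 1) : ℝ) * (poch σ n / poch τ (n + 1)) =
      N / ((n + 1) * (τ + n)) * ((N - 1).choose n * (poch σ n / poch τ n)) := by
  obtain ⟨M, rfl⟩ : ∃ M, N = M + 1 := ⟨N - 1, by omega⟩
  have h1 := (poch_pos hτ n).ne'
  have h2 : τ + n ≠ 0 := by positivity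
  have h3 : ((M + 1 : ℕ) : ℝ) * M.choose n = (M + 1).choose (n + 1) * ((n + 1 : ℕ) : ℝ) := by
    exact_mod_cast Nat.add_one_mul_choose_eq M n
  rw [poch_succ, Nat.add_sub_cancel]
  push_cast at h3 ⊢
  field_simp
  linear_combination (-poch σ n) * h3

lemma choose_mul_poch_div_poch_succ (σ : ℝ) {τ : ℝ} (hτ : 0 < τ) {n : ℕ} (hn : n + 1 ≤ N) :
    ((N - 1).choose (n + 1) : ℝ) * (poch σ (n + 1) / poch τ (n + 1)) =
      ((N : ℝ) - n - 1) * (σ + n) / ((n + 1) * (τ + n)) *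
        ((N - 1).choose n * (poch σ n / poch τ n)) := by
  obtain ⟨M, rfl⟩ : ∃ M, N = M + 1 := ⟨N - 1, by omega⟩
  have h1 := (poch_pos hτ n).ne'
  have h2 : τ + n ≠ 0 := by positivity
  have h3 : (M.choose (n + 1) : ℝ) * ((n + 1 : ℕ) : ℝ) = M.choose n * ((M : ℝ) - n) := by
    rw [← Nat.cast_sub (by omega)]
    exact_mod_cast Nat.choose_succ_right_eq M n
  rw [poch_succ, poch_succ, Nat.add_sub_cancel]
  push_cast at h3 ⊢
  field_simp
  linear_combination poch σ n * (σ + n) * h3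

/-! ### One-step increments as quadratic identities -/

section

variable {n u w A A' B D D' : ℝ} {N : ℝ}

/-- The increment in `n` of the identity for the squares of `h_{n+1}`. -/
lemma succ_sq_increment_of_contiguous (hN1 : N - 1 ≠ 0) (hβ : β + 1 ≠ 0)
    (hA : (β + 1) * A = (β + n + 2) * B + (n + 1) * (α + β + N + 2 + n) * u / (N - 1) * D)
    (hA' : (β + 1) * (A + A') = (2 * (n + 1) + α + β + 2) * (1 - u) * B)
    (hD : (α + β + 3 + n) * (N - n - 2) * D' =
      (N - 1) * (2 * n + α + β + 4) * B + (n + 1) * (α + β + N + 2 + n) * D) :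
    N * u * (1 - u) * (((α + β + n + 2) * (N - 2 * n - 2) - (n + 1) * N) *
          (2 * n + α + β + 3) * (D / ((β + 1) * (N - 1))) ^ 2) +
        u * (1 - u) * ((α + β + 2 + (n + 1)) * (N - (n + 1) - 1) / ((β + 1) * (N - 1)) * D') ^ 2 -
        u * (1 - u) * ((α + β + 2 + n) * (N - n - 1) / ((β + 1) * (N - 1)) * D) ^ 2 +
        (β - α) * (1 - u) * ((2 * (n + 1) + α + β + 2) * (B / (β + 1)) ^ 2) + A' ^ 2 - A ^ 2 =
      0 := by
  -- B and E serve as basis; every other value is a linear combination of them.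
  obtain ⟨E, hE⟩ : ∃ E, E = (n + 1) * (α + β + N + 2 + n) / (N - 1) * D := ⟨_, rfl⟩
  have hA1 : A = ((β + n + 2) * B + u * E) * (1 / (β + 1)) := by
    rw [mul_one_div, eq_div_iff hβ, hE]; linear_combination hA
  have hs : A' = (2 * (n + 1) + α + β + 2) * (1 - u) * B * (1 / (β + 1)) - A := by
    rw [mul_one_div, eq_sub_iff_add_eq, eq_div_iff hβ]; linear_combination hA'
  have hD1 : (α + β + 2 + (n + 1)) * (N - (n + 1) - 1) / ((β + 1) * (N - 1)) * D' =
      ((2 * n + α + β + 4) * B + E) * (1 / (β + 1)) := by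
    rw [hE]; field_simp; linear_combination hD
  -- The first bracket equals -e, so this is the factorisation of g² - q².
  have h3 : N * (((α + β + n + 2) * (N - 2 * n - 2) - (n + 1) * N) *
        (2 * n + α + β + 3) * (D / ((β + 1) * (N - 1))) ^ 2) -
        ((α + β + 2 + n) * (N - n - 1) / ((β + 1) * (N - 1)) * D) ^ 2 =
      -(E * (1 / (β + 1))) ^ 2 := by
    rw [hE]; field_simp; ring
  rw [hD1, hs, hA1, div_eq_mul_one_div B]
  generalize 1 / (β + 1) = i at *
  linear_combination u * (1 - u) * h3

/-- The increment in `n` of the identity for the squares of `h_n` with remainder `h_{n+1}`. -/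
lemma sq_pred_increment_of_contiguous (hN : N ≠ 0) (hN1 : N - 1 ≠ 0) (hβ : β + 1 ≠ 0)
    (hn : n + 1 ≠ 0) (hτ : α + β + N + 2 + n ≠ 0)
    (hA : (β + 1) * A = (β + n + 2) * B + (n + 1) * (α + β + N + 2 + n) * u / (N - 1) * D)
    (hA' : (β + 1) * (A + A') = (2 * (n + 1) + α + β + 2) * (1 - u) * B)
    (hD : (α + β + 3 + n) * (N - n - 2) * D' =
      (N - 1) * (2 * n + α + β + 4) * B + (n + 1) * (α + β + N + 2 + n) * D) :
    (2 * (n + 1) + α + β + 1) / N * ((α + β + 1) * (2 * (n + 1) - N) + 2 * (n + 1) ^ 2) *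
          (N / ((n + 1) * (α + β + N + 2 + n)) * w * A) ^ 2 +
        ((N - n - 1) * (α + β + 2 + n) / ((n + 1) * (α + β + N + 2 + n)) * w * A') ^ 2 -
        (w * A) ^ 2 +
        (β - α) * (1 - u) * ((2 * (n + 1) + α + β + 2) / (β + 1) ^ 2 *
          ((N - n - 1) * (α + β + 2 + n) / ((n + 1) * (α + β + N + 2 + n)) * w * B) ^ 2) +
        u * (1 - u) * ((α + β + 2 + (n + 1)) * (N - (n + 1) - 1) / (N - 1) *
          ((N - n - 1) * (α + β + 2 + n) / ((n + 1) * (α + β + N + 2 + n)) * w) *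
            (D' / (β + 1))) ^ 2 -
        u * (1 - u) * ((α + β + 2 + n) * (N - n - 1) / (N - 1) * w * (D / (β + 1))) ^ 2 = 0 := by
  -- If w is w_n, then v is w_{n+1}; the claim reduces to v² times
  -- `succ_sq_increment_of_contiguous`.
  set v := (N - n - 1) * (α + β + 2 + n) / ((n + 1) * (α + β + N + 2 + n)) * w with hv
  have h := succ_sq_increment_of_contiguous hN1 hβ hA hA' hD
  have hc : (N - n - 1) * (α + β + 2 + n) * w = (n + 1) * (α + β + N + 2 + n) * v := by
    rw [hv]; field_simp
  have h1 : (2 * (n + 1) + α + β + 1) / N * ((α + β + 1) * (2 * (n + 1) - N) + 2 * (n + 1) ^ 2) *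
      (N / ((n + 1) * (α + β + N + 2 + n)) * w * A) ^ 2 - (w * A) ^ 2 = -(v * A) ^ 2 := by
    have hg : N * (2 * (n + 1) + α + β + 1) *
        ((α + β + 1) * (2 * (n + 1) - N) + 2 * (n + 1) ^ 2) =
        ((n + 1) * (α + β + N + 2 + n)) ^ 2 - ((N - n - 1) * (α + β + 2 + n)) ^ 2 := by ring
    have hg0 : (n + 1) * (α + β + N + 2 + n) ≠ 0 := mul_ne_zero hn hτ
    rw [hv]
    generalize (n + 1) * (α + β + N + 2 + n) = g at hg hg0 ⊢
    generalize (N - n - 1) * (α + β + 2 + n) = q at hg ⊢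
    generalize (α + β + 1) * (2 * (n + 1) - N) + 2 * (n + 1) ^ 2 = e at hg ⊢
    generalize 2 * (n + 1) + α + β + 1 = k at hg ⊢
    field_simp
    linear_combination w ^ 2 * A ^ 2 * hg
  have h2 : (α + β + 2 + n) * (N - n - 1) / (N - 1) * w * (D / (β + 1)) =
      (n + 1) * (α + β + N + 2 + n) / (N - 1) * v * (D / (β + 1)) := by
    linear_combination D / (β + 1) / (N - 1) * hc
  have h3 : N * (((α + β + n + 2) * (N - 2 * n - 2) - (n + 1) * N) *
        (2 * n + α + β + 3) * (D / ((β + 1) * (N - 1))) ^ 2) -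
        ((α + β + 2 + n) * (N - n - 1) / ((β + 1) * (N - 1)) * D) ^ 2 =
      -((n + 1) * (α + β + N + 2 + n) / (N - 1) * (D / (β + 1))) ^ 2 := by
    field_simp; ring
  have h6 : (n + 1) * (α + β + N + 2 + n) / (N - 1) * v * (D / (β + 1)) =
      v * ((n + 1) * (α + β + N + 2 + n) / (N - 1) * (D / (β + 1))) := by ring
  have h4 : (α + β + 2 + (n + 1)) * (N - (n + 1) - 1) / (N - 1) * v * (D' / (β + 1)) =
      v * ((α + β + 2 + (n + 1)) * (N - (n + 1) - 1) / ((β + 1) * (N - 1)) * D') := by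
    field_simp
  have h5 : (2 * (n + 1) + α + β + 2) / (β + 1) ^ 2 * (v * B) ^ 2 =
      v ^ 2 * ((2 * (n + 1) + α + β + 2) * (B / (β + 1)) ^ 2) := by
    field_simp
  rw [h2, h4, h5, h6]
  generalize (α + β + 2 + (n + 1)) * (N - (n + 1) - 1) / ((β + 1) * (N - 1)) * D' = Z at h ⊢
  generalize (α + β + 2 + n) * (N - n - 1) / ((β + 1) * (N - 1)) * D = Y at h h3
  generalize ((α + β + n + 2) * (N - 2 * n - 2) - (n + 1) * N) * (2 * n + α + β + 3) *
    (D / ((β + 1) * (N - 1))) ^ 2 = X at h h3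
  generalize (2 * (n + 1) + α + β + 2) * (B / (β + 1)) ^ 2 = W at h ⊢
  generalize (2 * (n + 1) + α + β + 1) / N * ((α + β + 1) * (2 * (n + 1) - N) + 2 * (n + 1) ^ 2) *
    (N / ((n + 1) * (α + β + N + 2 + n)) * w * A) ^ 2 = T at h1 ⊢
  generalize (n + 1) * (α + β + N + 2 + n) / (N - 1) * (D / (β + 1)) = F at h3 ⊢
  linear_combination h1 + v ^ 2 * h - v ^ 2 * u * (1 - u) * h3

end

/-- The increment in `n` of the identity for the squares of `Q_n`. -/
lemma sq_increment_of_contiguous {α β n N u w A B C B' C' : ℝ} (hα : α + 1 ≠ 0) (hN : N ≠ 0)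
    (hn : n + 1 ≠ 0) (hτ : α + β + N + 2 + n ≠ 0)
    (hA : (α + 1) * A = (α + 1) * (1 - u) * B - (β + n + 1) * u * C)
    (hB : N * (2 * n + α + β + 3) * A =
      (N - n - 1) * (n + α + β + 2) * B' + (n + 1) * (N + n + α + β + 2) * B)
    (hC : N * (2 * n + α + β + 3) * (α + 1) * A =
      (N - n - 1) * (n + α + β + 2) * (α + n + 2) * C' -
        (n + 1) * (N + n + α + β + 2) * (β + n + 1) * C) :
    (2 * (n + 1) + α + β + 1) / N * ((α + β + 1) * (2 * (n + 1) - N) + 2 * (n + 1) ^ 2) *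
          (N / ((n + 1) * (α + β + N + 2 + n)) * w * A) ^ 2 +
        u * ((N - n - 1) * (α + β + 2 + n) / ((n + 1) * (α + β + N + 2 + n)) * w *
          ((α + (n + 1) + 1) / (α + 1)) * C') ^ 2 -
        u * (w * ((α + n + 1) / (α + 1)) * C) ^ 2 +
        (α - β) * u * ((2 * n + α + β + 2) * (w * (C / (α + 1))) ^ 2) +
        (1 - u) * ((N - n - 1) * (α + β + 2 + n) / ((n + 1) * (α + β + N + 2 + n)) * w * B') ^ 2 -
        (1 - u) * (w * B) ^ 2 = 0 := by
  have hA' : A = (1 - u) * B - (β + n + 1) / (α + 1) * u * C := by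
    field_simp
    linear_combination hA
  have hB' : (N - n - 1) * (α + β + 2 + n) / ((n + 1) * (α + β + N + 2 + n)) * w * B' =
      w * (N * (2 * n + α + β + 3) / ((n + 1) * (α + β + N + 2 + n)) * A - B) := by
    field_simp
    linear_combination (-w) * hB
  have hC' : (N - n - 1) * (α + β + 2 + n) / ((n + 1) * (α + β + N + 2 + n)) * w *
        ((α + (n + 1) + 1) / (α + 1)) * C' =
      w * (N * (2 * n + α + β + 3) / ((n + 1) * (α + β + N + 2 + n)) * A +
        (β + n + 1) / (α + 1) * C) := by
    field_simp
    linear_combination (-w) * hC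
  -- With c = N(2n+α+β+3)/g this says e/g = 2 - c. The c² A² terms then cancel, and what remains in
  -- A is 2c w² A times the relation `hA'`.
  have hcoef : ((α + β + 1) * (2 * (n + 1) - N) + 2 * (n + 1) ^ 2) /
      ((n + 1) * (α + β + N + 2 + n)) +
        N * (2 * n + α + β + 3) / ((n + 1) * (α + β + N + 2 + n)) = 2 := by
    field_simp
    ring
  have hT : (2 * (n + 1) + α + β + 1) / N *
      ((α + β + 1) * (2 * (n + 1) - N) + 2 * (n + 1) ^ 2) *
        (N / ((n + 1) * (α + β + N + 2 + n)) * w * A) ^ 2 =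
      N * (2 * n + α + β + 3) / ((n + 1) * (α + β + N + 2 + n)) *
        (((α + β + 1) * (2 * (n + 1) - N) + 2 * (n + 1) ^ 2) /
          ((n + 1) * (α + β + N + 2 + n))) * (w * A) ^ 2 := by
    field_simp
    ring
  have hba : ((β + n + 1) / (α + 1)) ^ 2 - ((α + n + 1) / (α + 1)) ^ 2 +
      (α - β) * (2 * n + α + β + 2) * (1 / (α + 1)) ^ 2 = 0 := by
    field_simp
    ring
  rw [hB', hC', hT, eq_sub_of_add_eq hcoef]
  generalize N * (2 * n + α + β + 3) / ((n + 1) * (α + β + N + 2 + n)) = c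
  generalize (β + n + 1) / (α + 1) = b at *
  linear_combination 2 * c * w ^ 2 * A * hA' + u * (w * C) ^ 2 * hba

/-! ### Identities (b) and (d) -/

lemma hahnQ_sq_sum (hα : -1 < α) (hβ : -1 < β) (x : ℝ) (n : ℕ) (hn : n + 1 ≤ N) :
      (∑ l ∈ Finset.Icc 1 n,
          (2 * (l : ℝ) + α + β + 1) / (N : ℝ) *
            ((α + β + 1) * (2 * (l : ℝ) - (N : ℝ)) + 2 * (l : ℝ) ^ 2) *
            ((N.choose l : ℝ) *
              (poch (α + β + 2) (l - 1) / poch (α + β + (N : ℝ) + 2) l) *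
              hahnQ l x α β N) ^ 2)
        + x / (N : ℝ) *
            (((N - 1).choose n : ℝ) *
              (poch (α + β + 2) n / poch (α + β + (N : ℝ) + 2) n) *
              ((α + (n : ℝ) + 1) / (α + 1)) *
              hahnQ n (x - 1) (α + 1) β (N - 1)) ^ 2
        + (α - β) * (x / (N : ℝ)) *
            (∑ l ∈ Finset.range n,
              (2 * (l : ℝ) + α + β + 2) *
                (((N - 1).choose l : ℝ) *
                  (poch (α + β + 2) l / poch (α + β + (N : ℝ) + 2) l) *
                  (hahnQ l (x - 1) (α + 1) β (N - 1) / (α + 1))) ^ 2)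
      = 1 - (1 - x / (N : ℝ)) *
            (((N - 1).choose n : ℝ) *
              (poch (α + β + 2) n / poch (α + β + (N : ℝ) + 2) n) *
              hahnQ n x α (β + 1) (N - 1)) ^ 2 := by
  have hα' : α + 1 ≠ 0 := by linarith
  induction n with
  | zero => simp [hahnQ_zero, poch_zero, div_self hα']
  | succ n ih =>
    have ih := ih (by omega)
    have hN : (0 : ℝ) < N := by exact_mod_cast (show 0 < N by omega)
    have hn0 : (0 : ℝ) ≤ n := n.cast_nonneg
    have hτ : 0 < α + β + (N : ℝ) + 2 := by linarith
    rw [Finset.sum_Icc_succ_top (by omega), Finset.sum_range_succ, Nat.add_sub_cancel,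
      choose_mul_poch_div_poch_top _ hτ (by omega), choose_mul_poch_div_poch_succ _ hτ (by omega)]
    obtain ⟨M, rfl⟩ : ∃ M, N = M + 1 := ⟨N - 1, by omega⟩
    have r1 := hahnQ_sub_succ (β := β) hα x M n
    have r2 := hahnQ_add_succ (β := β) hα x (show n ≤ M by omega)
    have r3 := hahnQ_succ_beta (β := β) hα x (show n + 1 ≤ M by omega)
    have r4 := hahnQ_succ_alpha (β := β) hα x (show n + 1 ≤ M by omega)
    have hM : ((M + 1 : ℕ) : ℝ) = (M : ℝ) + 1 := by push_cast; ring
    rw [← hM] at r1 r2 r3 r4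
    have hK : 2 * (n : ℝ) + α + β + 2 ≠ 0 := by linarith
    have key := sq_increment_of_contiguous (α := α) (β := β) (n := n) (N := (M + 1 : ℕ))
      (u := x / (M + 1 : ℕ))
      (w := (M.choose n : ℝ) * (poch (α + β + 2) n / poch (α + β + (M + 1 : ℕ) + 2) n))
      (A := hahnQ (n + 1) x α β (M + 1)) (B := hahnQ n x α (β + 1) M)
      (C := hahnQ n (x - 1) (α + 1) β M) (B' := hahnQ (n + 1) x α (β + 1) M)
      (C' := hahnQ (n + 1) (x - 1) (α + 1) β M) hα' hN.ne' (by positivity) (by positivity)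
      -- This combination eliminates Q_n(x, α, β, N).
      (mul_left_cancel₀ hK (by linear_combination (α + 1) * r2 - (β + n + 1) * r1))
      (by rw [r3, hM]; ring) (by rw [r4, hM]; ring)
    rw [Nat.add_sub_cancel] at ih ⊢
    rw [Nat.cast_add n 1, Nat.cast_one]
    linear_combination ih + key

lemma hahnH_sq_sum (hα : -1 < α) (hβ : -1 < β) (x : ℝ) (n : ℕ) (hn : n + 1 ≤ N) :
      (∑ l ∈ Finset.Icc 1 n,
          (2 * (l : ℝ) + α + β + 1) / (N : ℝ) *
            ((α + β + 1) * (2 * (l : ℝ) - (N : ℝ)) + 2 * (l : ℝ) ^ 2) *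
            (poch (α + β + 2) (l - 1) / poch (α + β + (N : ℝ) + 2) l *
              (N.choose l : ℝ) * hahnH l x α β N) ^ 2)
        + (β - α) * (1 - x / (N : ℝ)) *
            (∑ l ∈ Finset.range n,
              (2 * (l : ℝ) + α + β + 2) *
                (((N - 1).choose l : ℝ) *
                  (poch (α + β + 2) l / poch (α + β + (N : ℝ) + 2) l) *
                  (hahnH l x α (β + 1) (N - 1) / (β + 1))) ^ 2)
        + (1 - x / (N : ℝ)) *
            (((N - 1).choose n : ℝ) * ((β + (n : ℝ) + 1) / (β + 1)) *
              (poch (α + β + 2) n / poch (α + β + (N : ℝ) + 2) n) *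
              hahnH n x α (β + 1) (N - 1)) ^ 2
      = 1 - x / (N : ℝ) *
            (((N - 1).choose n : ℝ) *
              (poch (α + β + 2) n / poch (α + β + (N : ℝ) + 2) n) *
              hahnH n (x - 1) (α + 1) β (N - 1)) ^ 2 := by
  have hβ' : β + 1 ≠ 0 := by linarith
  induction n with
  | zero => simp [hahnH_zero, poch_zero, div_self hβ']
  | succ n ih =>
    have ih := ih (by omega)
    have hN : (0 : ℝ) < N := by exact_mod_cast (show 0 < N by omega)
    have hn0 : (0 : ℝ) ≤ n := n.cast_nonneg
    have hτ : 0 < α + β + (N : ℝ) + 2 := by linarith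
    have hK : 2 * (n : ℝ) + α + β + 2 ≠ 0 := by linarith
    rw [Finset.sum_Icc_succ_top (by omega), Finset.sum_range_succ, Nat.add_sub_cancel,
      mul_comm (poch (α + β + 2) n / poch (α + β + (N : ℝ) + 2) (n + 1)),
      mul_right_comm (((N - 1).choose (n + 1) : ℕ) : ℝ),
      choose_mul_poch_div_poch_top _ hτ (by omega), choose_mul_poch_div_poch_succ _ hτ (by omega)]
    have r1 := hahnH_sub_succ hα hβ x (show 1 ≤ N by omega) n
    have r2 := hahnH_add_succ hα hβ x (show n + 1 ≤ N by omega)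
    have r3 := hahnH_succ_beta hα hβ x (show n + 2 ≤ N by omega)
    have r4 := hahnH_succ_alpha hα hβ x (show n + 2 ≤ N by omega)
    -- Reflection swaps α with β and u with 1 - u; the minus signs are the relative factor
    -- (-1)^(n+1) / (-1)^n.
    have key := sq_increment_of_contiguous (α := β) (β := α) (n := n) (N := N)
      (u := 1 - x / N)
      (w := ((N - 1).choose n : ℝ) * (poch (α + β + 2) n / poch (α + β + N + 2) n))
      (A := -hahnH (n + 1) x α β N) (B := hahnH n (x - 1) (α + 1) β (N - 1))
      (C := hahnH n x α (β + 1) (N - 1)) (B' := -hahnH (n + 1) (x - 1) (α + 1) β (N - 1))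
      (C' := -hahnH (n + 1) x α (β + 1) (N - 1)) hβ' hN.ne' (by positivity)
      (by rw [add_comm β α]; positivity)
      (mul_left_cancel₀ hK (by linear_combination (β + 1) * r1 - (α + n + 1) * r2))
      (by linear_combination -r4) (by linear_combination -r3)
    rw [add_comm β α] at key
    rw [Nat.cast_add n 1, Nat.cast_one]
    linear_combination ih + key

/-! ### Identities (c) and (a) -/

/-- The contiguous relations for `h` that involve both parameter shifts, with `h_{n+1}(β + 1)` and
`h_n(α + 1, β + 1)` as basis. -/
lemma hahnH_contiguous_alpha_beta (hα : -1 < α) (hβ : -1 < β) (x : ℝ) {n : ℕ} (hn : n + 3 ≤ N) :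
    (β + 1) * hahnH (n + 1) x α β N = (β + n + 2) * hahnH (n + 1) x α (β + 1) (N - 1) +
        (n + 1) * (α + β + N + 2 + n) * (x / N) / ((N : ℝ) - 1) *
          hahnH n (x - 1) (α + 1) (β + 1) (N - 2) ∧
      (α + β + 3 + n) * ((N : ℝ) - n - 2) * hahnH (n + 1) (x - 1) (α + 1) (β + 1) (N - 2) =
        ((N : ℝ) - 1) * (2 * n + α + β + 4) * hahnH (n + 1) x α (β + 1) (N - 1) +
          (n + 1) * (α + β + N + 2 + n) * hahnH n (x - 1) (α + 1) (β + 1) (N - 2) := by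
  have hN1 : ((N - 1 : ℕ) : ℝ) = (N : ℝ) - 1 := by rw [Nat.cast_sub (by omega)]; simp
  have hN : (3 : ℝ) ≤ N := by exact_mod_cast (show 3 ≤ N by omega)
  have hN0 : (N : ℝ) - 1 ≠ 0 := by linarith
  have hn0 : (0 : ℝ) ≤ n := n.cast_nonneg
  have r1 := hahnH_sub_succ hα (show -1 < β + 1 by linarith) x (show 1 ≤ N - 1 by omega) n
  have r4 := hahnH_succ_alpha hα (show -1 < β + 1 by linarith) x (show n + 2 ≤ N - 1 by omega)
  have r3 := hahnH_succ_beta hα hβ x (show n + 2 ≤ N by omega)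
  rw [Nat.sub_sub, hN1] at r1 r4
  constructor
  · have hc : (N : ℝ) * (2 * n + α + β + 3) ≠ 0 := by
      have : 0 < 2 * (n : ℝ) + α + β + 3 := by linarith
      positivity
    refine mul_left_cancel₀ hc ?_
    have hx : x / ((N : ℝ) - 1) = N * (x / N) / ((N : ℝ) - 1) := by
      rw [mul_div_cancel₀]; linarith
    -- The sum below eliminates h_n(x, α, β+1, N-1).
    rw [hx] at r1
    linear_combination r3 + (n + 1) * ((N : ℝ) + n + α + β + 2) * r1
  · linear_combination -r4

/-- Supplies the base cases of (c) and (a). -/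
lemma hahnH_one (hα : -1 < α) (hβ : -1 < β) (x : ℝ) (hN : 1 ≤ N) :
    hahnH 1 x α β N = (α + β + 2) * (1 - x / N) / (β + 1) - 1 := by
  have hβ' : β + 1 ≠ 0 := by linarith
  have h := hahnH_add_succ hα hβ x (n := 0) hN
  rw [hahnH_zero, hahnH_zero] at h
  generalize x / (N : ℝ) = u at *
  push_cast at h
  field_simp
  linear_combination h

lemma hahnH_succ_sq_sum (hα : -1 < α) (hβ : -1 < β) (x : ℝ) (n : ℕ) (hn : n + 2 ≤ N) :
      x * (1 - x / (N : ℝ)) *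
            (∑ l ∈ Finset.range n,
              ((α + β + (l : ℝ) + 2) * ((N : ℝ) - 2 * (l : ℝ) - 2) - ((l : ℝ) + 1) * (N : ℝ)) *
                (2 * (l : ℝ) + α + β + 3) *
                (hahnH l (x - 1) (α + 1) (β + 1) (N - 2) / ((β + 1) * ((N : ℝ) - 1))) ^ 2)
        + x / (N : ℝ) * (1 - x / (N : ℝ)) *
            ((α + β + 2 + (n : ℝ)) * ((N : ℝ) - (n : ℝ) - 1) / ((β + 1) * ((N : ℝ) - 1)) *
              hahnH n (x - 1) (α + 1) (β + 1) (N - 2)) ^ 2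
        + (β - α) * (1 - x / (N : ℝ)) *
            (∑ l ∈ Finset.range (n + 1),
              (2 * (l : ℝ) + α + β + 2) *
                (hahnH l x α (β + 1) (N - 1) / (β + 1)) ^ 2)
      = 1 - (hahnH (n + 1) x α β N) ^ 2 := by
  have hβ' : β + 1 ≠ 0 := by linarith
  have hN : (2 : ℝ) ≤ N := by exact_mod_cast (show 2 ≤ N by omega)
  have hN1 : (N : ℝ) - 1 ≠ 0 := by linarith
  have hN0 : (N : ℝ) ≠ 0 := by linarith
  induction n with
  | zero =>
    rw [zero_add, hahnH_one hα hβ x (by omega)]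
    simp only [Finset.range_zero, Finset.sum_empty, Finset.sum_range_one, hahnH_zero]
    generalize x / (N : ℝ) = u
    push_cast
    field_simp
    ring
  | succ n ih =>
    have ih := ih (by omega)
    obtain ⟨hA, hD⟩ := hahnH_contiguous_alpha_beta hα hβ x hn
    have r2 := hahnH_add_succ hα hβ x (show n + 1 + 1 ≤ N by omega)
    rw [Finset.sum_range_succ, Finset.sum_range_succ _ (n + 1)]
    push_cast at r2 ⊢
    have key := succ_sq_increment_of_contiguous hN1 hβ' hA r2 hD
    have hx : (N : ℝ) * (x / N) = x := by field_simp
    rw [hx] at key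
    linear_combination ih + key

/-- Brings the remainder weight of (a) to w_m, through (N-1) C(N-2,m) = (N-1-m) C(N-1,m). -/
lemma poch_succ_div_poch_mul_choose (hα : -1 < α) (hβ : -1 < β) {m : ℕ} (hm : m + 2 ≤ N) :
    poch (α + β + 2) (m + 1) / poch (α + β + (N : ℝ) + 2) m * ((N - 2).choose m : ℝ) =
      (α + β + 2 + m) * ((N : ℝ) - m - 1) / ((N : ℝ) - 1) *
        (((N - 1).choose m : ℝ) * (poch (α + β + 2) m / poch (α + β + (N : ℝ) + 2) m)) := by
  obtain ⟨M, rfl⟩ : ∃ M, N = M + 2 := ⟨N - 2, by omega⟩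
  have hM : (0 : ℝ) ≤ M := M.cast_nonneg
  have hN1 : (M : ℝ) + 2 - 1 ≠ 0 := by linarith
  have h : (M.choose m : ℝ) * ((M : ℝ) + 1) = (M + 1).choose m * ((M : ℝ) + 1 - m) := by
    have := Nat.choose_mul_succ_eq M m
    rw [← Nat.cast_succ, ← Nat.cast_sub (by omega)]
    exact_mod_cast this
  have h1 := (poch_pos (show 0 < α + β + ((M : ℝ) + 2) + 2 by linarith) m).ne'
  rw [poch_succ, Nat.add_sub_cancel, show M + 2 - 1 = M + 1 by omega]
  push_cast
  field_simp
  linear_combination poch (α + β + 2) m * (α + β + 2 + m) * h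

/-- Adding an increment to both sides of a summation identity with remainder. -/
lemma sum_identity_add_increment {S t r r' k T t' z z' : ℝ} (h : S + r + k * T = 1 - z)
    (h' : t + r' - r + k * t' + z' - z = 0) : S + t + r' + k * (T + t') = 1 - z' := by
  linear_combination h + h'

lemma hahnH_sq_sum_pred (hα : -1 < α) (hβ : -1 < β) (x : ℝ) (n : ℕ) (hn : n + 2 ≤ N) :
      (∑ l ∈ Finset.Icc 1 n,
          (2 * (l : ℝ) + α + β + 1) / (N : ℝ) *
            ((α + β + 1) * (2 * (l : ℝ) - (N : ℝ)) + 2 * (l : ℝ) ^ 2) *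
            (poch (α + β + 2) (l - 1) / poch (α + β + (N : ℝ) + 2) l *
              (N.choose l : ℝ) * hahnH l x α β N) ^ 2)
        + (((N - 1).choose n : ℝ) *
            (poch (α + β + 2) n / poch (α + β + (N : ℝ) + 2) n) *
            hahnH (n + 1) x α β N) ^ 2
        + (β - α) * (1 - x / (N : ℝ)) *
            (∑ l ∈ Finset.range (n + 1),
              (2 * (l : ℝ) + α + β + 2) / (β + 1) ^ 2 *
                (((N - 1).choose l : ℝ) *
                  (poch (α + β + 2) l / poch (α + β + (N : ℝ) + 2) l) *
                  hahnH l x α (β + 1) (N - 1)) ^ 2)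
      = 1 - x / (N : ℝ) * (1 - x / (N : ℝ)) *
            (poch (α + β + 2) (n + 1) / poch (α + β + (N : ℝ) + 2) n *
              ((N - 2).choose n : ℝ) *
              (hahnH n (x - 1) (α + 1) (β + 1) (N - 2) / (β + 1))) ^ 2 := by
  have hβ' : β + 1 ≠ 0 := by linarith
  have hN : (2 : ℝ) ≤ N := by exact_mod_cast (show 2 ≤ N by omega)
  have hN1 : (N : ℝ) - 1 ≠ 0 := by linarith
  have hN0 : (N : ℝ) ≠ 0 := by linarith
  have hτ : 0 < α + β + (N : ℝ) + 2 := by linarith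
  induction n with
  | zero =>
    rw [poch_succ_div_poch_mul_choose hα hβ hn, zero_add, hahnH_one hα hβ x (by omega)]
    simp only [Finset.sum_range_one, hahnH_zero, poch_zero, Nat.choose_zero_right]
    rw [Finset.Icc_eq_empty (by omega), Finset.sum_empty]
    generalize x / (N : ℝ) = u
    push_cast
    field_simp
    ring
  | succ n ih =>
    have ih := ih (by omega)
    have hn0 : (0 : ℝ) ≤ n := n.cast_nonneg
    obtain ⟨hA, hD⟩ := hahnH_contiguous_alpha_beta hα hβ x hn
    have r2 := hahnH_add_succ hα hβ x (show n + 1 + 1 ≤ N by omega)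
    rw [poch_succ_div_poch_mul_choose hα hβ (by omega)] at ih
    rw [poch_succ_div_poch_mul_choose hα hβ hn, Finset.sum_Icc_succ_top (by omega), Finset.sum_range_succ _ (n + 1),
      Nat.add_sub_cancel,
      mul_comm (poch (α + β + 2) n / poch (α + β + (N : ℝ) + 2) (n + 1)),
      choose_mul_poch_div_poch_top _ hτ (by omega), choose_mul_poch_div_poch_succ _ hτ (by omega)]
    push_cast at r2 ⊢
    have key := sq_pred_increment_of_contiguous
      (w := ((N - 1).choose n : ℝ) * (poch (α + β + 2) n / poch (α + β + (N : ℝ) + 2) n))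
      hN0 hN1 hβ' (by positivity) (by positivity) hA r2 hD
    exact sum_identity_add_increment ih key

end

theorem theorem3p1 (N : ℕ) (α β : ℝ) (hα : -1 < α) (hβ : -1 < β) (x : ℝ) :
    -- identity (a)
    (∀ n : ℕ, 1 ≤ n → n + 1 ≤ N →
      (∑ l ∈ Finset.Icc 1 (n - 1),
          (2 * (l : ℝ) + α + β + 1) / (N : ℝ) *
            ((α + β + 1) * (2 * (l : ℝ) - (N : ℝ)) + 2 * (l : ℝ) ^ 2) *
            (poch (α + β + 2) (l - 1) / poch ((N : ℝ) + α + β + 2) l *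
              (N.choose l : ℝ) * hahnH l x α β N) ^ 2)
        + (((N - 1).choose (n - 1) : ℝ) *
            (poch (α + β + 2) (n - 1) / poch ((N : ℝ) + α + β + 2) (n - 1)) *
            hahnH n x α β N) ^ 2
        + (β - α) * (1 - x / (N : ℝ)) *
            (∑ l ∈ Finset.range n,
              (2 * (l : ℝ) + α + β + 2) / (β + 1) ^ 2 *
                (((N - 1).choose l : ℝ) *
                  (poch (α + β + 2) l / poch (α + β + (N : ℝ) + 2) l) *
                  hahnH l x α (β + 1) (N - 1)) ^ 2)
      = 1 - x / (N : ℝ) * (1 - x / (N : ℝ)) *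
            (poch (α + β + 2) n / poch (α + β + (N : ℝ) + 2) (n - 1) *
              ((N - 2).choose (n - 1) : ℝ) *
              (hahnH (n - 1) (x - 1) (α + 1) (β + 1) (N - 2) / (β + 1))) ^ 2) ∧
    -- identity (b)
    (∀ n : ℕ, n + 1 ≤ N →
      (∑ l ∈ Finset.Icc 1 n,
          (2 * (l : ℝ) + α + β + 1) / (N : ℝ) *
            ((α + β + 1) * (2 * (l : ℝ) - (N : ℝ)) + 2 * (l : ℝ) ^ 2) *
            ((N.choose l : ℝ) *
              (poch (α + β + 2) (l - 1) / poch (α + β + (N : ℝ) + 2) l) *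
              hahnQ l x α β N) ^ 2)
        + x / (N : ℝ) *
            (((N - 1).choose n : ℝ) *
              (poch (α + β + 2) n / poch (α + β + (N : ℝ) + 2) n) *
              ((α + (n : ℝ) + 1) / (α + 1)) *
              hahnQ n (x - 1) (α + 1) β (N - 1)) ^ 2
        + (α - β) * (x / (N : ℝ)) *
            (∑ l ∈ Finset.range n,
              (2 * (l : ℝ) + α + β + 2) *
                (((N - 1).choose l : ℝ) *
                  (poch (α + β + 2) l / poch (α + β + (N : ℝ) + 2) l) *
                  (hahnQ l (x - 1) (α + 1) β (N - 1) / (α + 1))) ^ 2)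
      = 1 - (1 - x / (N : ℝ)) *
            (((N - 1).choose n : ℝ) *
              (poch (α + β + 2) n / poch (α + β + (N : ℝ) + 2) n) *
              hahnQ n x α (β + 1) (N - 1)) ^ 2) ∧
    -- identity (c)
    (∀ n : ℕ, n + 2 ≤ N →
      x * (1 - x / (N : ℝ)) *
            (∑ l ∈ Finset.range n,
              ((α + β + (l : ℝ) + 2) * ((N : ℝ) - 2 * (l : ℝ) - 2) - ((l : ℝ) + 1) * (N : ℝ)) *
                (2 * (l : ℝ) + α + β + 3) *
                (hahnH l (x - 1) (α + 1) (β + 1) (N - 2) / ((β + 1) * ((N : ℝ) - 1))) ^ 2)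
        + x / (N : ℝ) * (1 - x / (N : ℝ)) *
            ((α + β + 2 + (n : ℝ)) * ((N : ℝ) - (n : ℝ) - 1) / ((β + 1) * ((N : ℝ) - 1)) *
              hahnH n (x - 1) (α + 1) (β + 1) (N - 2)) ^ 2
        + (β - α) * (1 - x / (N : ℝ)) *
            (∑ l ∈ Finset.range (n + 1),
              (2 * (l : ℝ) + α + β + 2) *
                (hahnH l x α (β + 1) (N - 1) / (β + 1)) ^ 2)
      = 1 - (hahnH (n + 1) x α β N) ^ 2) ∧
    -- identity (d)
    (∀ n : ℕ, n + 1 ≤ N →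
      (∑ l ∈ Finset.Icc 1 n,
          (2 * (l : ℝ) + α + β + 1) / (N : ℝ) *
            ((α + β + 1) * (2 * (l : ℝ) - (N : ℝ)) + 2 * (l : ℝ) ^ 2) *
            (poch (α + β + 2) (l - 1) / poch (α + β + (N : ℝ) + 2) l *
              (N.choose l : ℝ) * hahnH l x α β N) ^ 2)
        + (β - α) * (1 - x / (N : ℝ)) *
            (∑ l ∈ Finset.range n,
              (2 * (l : ℝ) + α + β + 2) *
                (((N - 1).choose l : ℝ) *
                  (poch (α + β + 2) l / poch (α + β + (N : ℝ) + 2) l) *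
                  (hahnH l x α (β + 1) (N - 1) / (β + 1))) ^ 2)
        + (1 - x / (N : ℝ)) *
            (((N - 1).choose n : ℝ) * ((β + (n : ℝ) + 1) / (β + 1)) *
              (poch (α + β + 2) n / poch (α + β + (N : ℝ) + 2) n) *
              hahnH n x α (β + 1) (N - 1)) ^ 2
      = 1 - x / (N : ℝ) *
            (((N - 1).choose n : ℝ) *
              (poch (α + β + 2) n / poch (α + β + (N : ℝ) + 2) n) *
              hahnH n (x - 1) (α + 1) β (N - 1)) ^ 2) := by
  refine ⟨fun n h1 hn => ?_, fun n hn => hahnQ_sq_sum hα hβ x n hn,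
    fun n hn => hahnH_succ_sq_sum hα hβ x n hn, fun n hn => hahnH_sq_sum hα hβ x n hn⟩
  -- Identity (a) starts at n = 1, so its induction variable is m = n - 1.
  obtain ⟨m, rfl⟩ : ∃ m, n = m + 1 := ⟨n - 1, by omega⟩
  rw [Nat.add_sub_cancel, show (N : ℝ) + α + β + 2 = α + β + N + 2 by ring]
  exact hahnH_sq_sum_pred hα hβ x m hn
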